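/- Let $(\mathscr{M},\otimes,I)$ be a monoidal category acting on a category $\mathscr{C}$, with action written $M\cdot A$. All coends of sets below are taken in a universe of sets large enough for them to exist; in particular profunctors take values in such sets. **Optics.** For $S,S',A,A'\in\mathscr{C}$, the set of optics $(S,S')\to(A,A')$ is $\int^{M\in\mathscr{M}}\mathscr{C}(S,M\cdot A)\times\mathscr{C}(M\cdot A',S')$; write $\langle l\mid r\rangle$ for the class of $(l,r)$. An optic $p=\langle l\mid r\rangle$ from $(S,S)$ to $(A,A)$, with residual $M$, is *lawful* if $r\circ l=\mathrm{id}_S$ and $$\langle l\mid \mathrm{id}_{M\cdot A}\mid r\rangle=\langle l\mid l\circ r\mid r\rangle\quad\text{in}\quad\int^{M_1,M_2\in\mathscr{M}}\mathscr{C}(S,M_1\cdot A)\times\mathscr{C}(M_1\cdot A,M_2\cdot A)\times\mathscr{C}(M_2\cdot A,S)$$ (both conditions are independent of the representative). **Tambara modules.** A Tambara module is a profunctor $P:\mathscr{C}^{\mathrm{op}}\times\mathscr{C}\to\mathbf{Set}$ with maps $\zeta_{A,B,M}:P(A,B)\to P(M\cdot A,M\cdot B)$, natural in $A,B$, dinatural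 in $M$, and compatible with the associativity and unit isomorphisms of the action. Morphisms are natural transformations commuting with $\zeta$. Tambara modules form a monoidal category $\mathbf{Tamb}_{\mathscr{M}}$ under profunctor composition $(P\odot Q)(A,B)=\int^{Z}P(A,Z)\times Q(Z,B)$, with $\zeta[x,y]=[\zeta x,\zeta y]$ and with unit the hom-profunctor $\mathscr{C}(-,=)$. Let $(U-)(A,A'):\mathbf{Tamb}_{\mathscr{M}}\to\mathbf{Set}$ be the functor $P\mapsto P(A,A')$. Let $\Phi E_{A,A'}$ be the Tambara module whose value at $(X,Y)$ is the set of optics $(X,Y)\to(A,A')$, with $\zeta\langle l\mid r\rangle=\langle M\cdot l\mid M\cdot r\rangle$ (the free Tambara module on the exchange profunctor $\mathscr{C}(-,A)\times\mathscr{C}(A',=)$). It represents $(U-)(A,A')$ through evaluation at the identity optic, so by the Yoneda lemma optics $p:(S,S')\to(A,A')$ correspond bijectively to natural transformations $\tilde p:(U-)(A,A')\Rightarrow(U-)(S,S')$; explicitly, for $p=\langle l\mid r\rangle$ with residual $M$, $\tilde p_P(x)=P(l,r)(\zeta_{A,A',M}(x))$. The module $\Phi E_{A,A}$ is a comonoid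 in $\mathbf{Tamb}_{\mathscr{M}}$ with counit $\langle l\mid r\rangle\mapsto r\circ l$ and comultiplication $\langle l\mid r\rangle\mapsto[\langle l\mid\mathrm{id}\rangle,\langle\mathrm{id}\mid r\rangle]$. Consequently the functor it represents, $(U-)(A,A)$, carries a canonical lax monoidal structure with respect to $\odot$ and $\times$. **Theorem.** For every optic $p:(S,S)\to(A,A)$: 1. $p$ is lawful if and only if the natural transformation $\tilde p:(U-)(A,A)\Rightarrow(U-)(S,S)$ is monoidal with respect to the canonical lax monoidal structures on $(U-)(A,A)$ and $(U-)(S,S)$. 2. Equivalently, $p$ is lawful if and only if $\tilde p$ satisfies the folklore profunctor optic laws: $\tilde p_{\mathscr{C}(-,=)}(\mathrm{id}_A)=\mathrm{id}_S$, and $\tilde p_{P\odot Q}([x,y])=[\tilde p_P(x),\tilde p_Q(y)]$ for all Tambara modules $P,Q$ and all $x\in P(A,A)$, $y\in Q(A,A)$. -/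

import Mathlib

open CategoryTheory MonoidalCategory MonoidalLeftAction Opposite

universe w v u v₁ u₁

namespace ProfunctorOptics

/-! ### Optics for an action of a monoidal category `M` on a category `C` -/

section Optics

variable (M : Type u₁) [Category.{v₁} M] [MonoidalCategory M]
  {C : Type u} [Category.{v} C] [MonoidalLeftAction M C]

/-- Representatives of optics `(S, S') ⇸ (A, A')`: a residual `m` with maps `l : S ⟶ m ⬝ A` and
`r : m ⬝ A' ⟶ S'`. -/
structure OpticRep (S S' A A' : C) : Type (max u₁ v) where
  res : M
  l : S ⟶ res ⊙ₗ A
  r : res ⊙ₗ A' ⟶ S'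

/-- The relation generating the coend: `⟨l ≫ (f ⬝ A) ∣ r⟩ ∼ ⟨l ∣ (f ⬝ A') ≫ r⟩`. -/
inductive OpticRel (S S' A A' : C) : OpticRep M S S' A A' → OpticRep M S S' A A' → Prop
  | slide {m n : M} (f : m ⟶ n) (l : S ⟶ m ⊙ₗ A) (r : n ⊙ₗ A' ⟶ S') :
      OpticRel S S' A A' ⟨n, l ≫ f ⊵ₗ A, r⟩ ⟨m, l, f ⊵ₗ A' ≫ r⟩

/-- The set of optics `(S, S') ⇸ (A, A')`, that is, the coend
`∫^{m : M} C(S, m ⬝ A) × C(m ⬝ A', S')`. -/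
def Optic (S S' A A' : C) : Type (max u₁ v) := Quot (OpticRel M S S' A A')

variable {M}

/-- The optic `⟨l ∣ r⟩` represented by `l` and `r`. -/
def Optic.mk {S S' A A' : C} (m : M) (l : S ⟶ m ⊙ₗ A) (r : m ⊙ₗ A' ⟶ S') :
    Optic M S S' A A' :=
  Quot.mk _ ⟨m, l, r⟩

theorem Optic.slide {S S' A A' : C} {m n : M} (f : m ⟶ n) (l : S ⟶ m ⊙ₗ A)
    (r : n ⊙ₗ A' ⟶ S') : Optic.mk n (l ≫ f ⊵ₗ A) r = Optic.mk m l (f ⊵ₗ A' ≫ r) :=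
  Quot.sound (OpticRel.slide f l r)

theorem Optic.ind {S S' A A' : C} {motive : Optic M S S' A A' → Prop}
    (h : ∀ m l r, motive (Optic.mk m l r)) (p : Optic M S S' A A') : motive p :=
  Quot.ind (fun ⟨m, l, r⟩ => h m l r) p

/-- The universal property of the coend defining optics. -/
def Optic.lift {S S' A A' : C} {X : Type*}
    (f : ∀ m : M, (S ⟶ m ⊙ₗ A) → (m ⊙ₗ A' ⟶ S') → X)
    (h : ∀ {m n : M} (t : m ⟶ n) (l : S ⟶ m ⊙ₗ A) (r : n ⊙ₗ A' ⟶ S'),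
      f n (l ≫ t ⊵ₗ A) r = f m l (t ⊵ₗ A' ≫ r)) :
    Optic M S S' A A' → X :=
  Quot.lift (fun p => f p.res p.l p.r) (by rintro _ _ ⟨t, l, r⟩; exact h t l r)

@[simp]
theorem Optic.lift_mk {S S' A A' : C} {X : Type*}
    (f : ∀ m : M, (S ⟶ m ⊙ₗ A) → (m ⊙ₗ A' ⟶ S') → X)
    (h : ∀ {m n : M} (t : m ⟶ n) (l : S ⟶ m ⊙ₗ A) (r : n ⊙ₗ A' ⟶ S'),
      f n (l ≫ t ⊵ₗ A) r = f m l (t ⊵ₗ A' ≫ r)) (m : M) (l : S ⟶ m ⊙ₗ A) (r : m ⊙ₗ A' ⟶ S') :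
    Optic.lift f h (Optic.mk m l r) = f m l r := rfl

/-- Functoriality of optics in `(S, S')`: `⟨l ∣ r⟩ ↦ ⟨f ≫ l ∣ r ≫ g⟩`. -/
def Optic.map {S S' T T' A A' : C} (f : T ⟶ S) (g : S' ⟶ T') :
    Optic M S S' A A' → Optic M T T' A A' :=
  Optic.lift (fun m l r => Optic.mk m (f ≫ l) (r ≫ g))
    (fun t l r => by simpa using Optic.slide t (f ≫ l) (r ≫ g))

@[simp]
theorem Optic.map_mk {S S' T T' A A' : C} (f : T ⟶ S) (g : S' ⟶ T') (m : M) (l : S ⟶ m ⊙ₗ A)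
    (r : m ⊙ₗ A' ⟶ S') : Optic.map f g (Optic.mk m l r) = Optic.mk m (f ≫ l) (r ≫ g) := rfl

/-- The action of `n : M` on optics: `⟨l ∣ r⟩ ↦ ⟨n ⬝ l ∣ n ⬝ r⟩`. -/
def Optic.act (n : M) {S S' A A' : C} :
    Optic M S S' A A' → Optic M (n ⊙ₗ S) (n ⊙ₗ S') A A' :=
  Optic.lift
    (fun m l r => Optic.mk (n ⊗ m) (n ⊴ₗ l ≫ (αₗ n m A).inv) ((αₗ n m A').hom ≫ n ⊴ₗ r))
    (fun {m m'} t l r => by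
      have := Optic.slide (n ◁ t) (n ⊴ₗ l ≫ (αₗ n m A).inv) ((αₗ n m' A').hom ≫ n ⊴ₗ r)
      simpa using this)

@[simp]
theorem Optic.act_mk (n : M) {S S' A A' : C} (m : M) (l : S ⟶ m ⊙ₗ A) (r : m ⊙ₗ A' ⟶ S') :
    Optic.act n (Optic.mk m l r) =
      Optic.mk (n ⊗ m) (n ⊴ₗ l ≫ (αₗ n m A).inv) ((αₗ n m A').hom ≫ n ⊴ₗ r) := rfl

theorem Optic.act_map (n : M) {S S' T T' A A' : C} (f : T ⟶ S) (g : S' ⟶ T')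
    (p : Optic M S S' A A') :
    Optic.act n (Optic.map f g p) = Optic.map (n ⊴ₗ f) (n ⊴ₗ g) (Optic.act n p) := by
  induction p using Optic.ind with
  | h m l r => simp

theorem Optic.act_dinatural {n n' : M} (t : n ⟶ n') {S S' A A' : C} (p : Optic M S S' A A') :
    Optic.map (𝟙 _) (t ⊵ₗ S') (Optic.act n p) = Optic.map (t ⊵ₗ S) (𝟙 _) (Optic.act n' p) := by
  induction p using Optic.ind with
  | h m l r =>
    have h := Optic.slide (t ▷ m) (n ⊴ₗ l ≫ (αₗ n m A).inv) ((αₗ n' m A').hom ≫ n' ⊴ₗ r)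
    simp only [whiskerRight_actionHomLeft, Category.assoc, Iso.inv_hom_id_assoc] at h
    simp only [Optic.act_mk, Optic.map_mk, Category.id_comp, Category.comp_id, Category.assoc,
      action_exchange]
    rw [action_exchange_assoc] at h
    exact h.symm

theorem Optic.act_tensor (n n' : M) {S S' A A' : C} (p : Optic M S S' A A') :
    Optic.map (αₗ n n' S).inv (αₗ n n' S').hom (Optic.act (n ⊗ n') p) =
      Optic.act n (Optic.act n' p) := by
  induction p using Optic.ind with
  | h m l r =>
    have h₁ : (α_ n n' m).hom ⊵ₗ A = (αₗ (n ⊗ n') m A).hom ≫ (αₗ n n' (m ⊙ₗ A)).hom ≫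
        n ⊴ₗ (αₗ n' m A).inv ≫ (αₗ n (n' ⊗ m) A).inv := by
      rw [← associator_actionHom_assoc]
      simp
    have h := Optic.slide (α_ n n' m).hom
      ((αₗ n n' S).inv ≫ (n ⊗ n') ⊴ₗ l ≫ (αₗ (n ⊗ n') m A).inv)
      ((αₗ n (n' ⊗ m) A').hom ≫ n ⊴ₗ (αₗ n' m A').hom ≫ n ⊴ₗ n' ⊴ₗ r)
    rw [associator_actionHom_assoc, h₁] at h
    simpa using h.symm

theorem Optic.act_unit {S S' A A' : C} (p : Optic M S S' A A') :
    Optic.map (λₗ[M] S).inv (λₗ[M] S').hom (Optic.act (𝟙_ M) p) = p := by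
  induction p using Optic.ind with
  | h m l r =>
    have h := Optic.slide (λ_ m).hom
      ((λₗ[M] S).inv ≫ (𝟙_ M) ⊴ₗ l ≫ (αₗ (𝟙_ M) m A).inv) r
    simpa using h.symm

variable (M)

/-- The identity optic `⟨λ⁻¹ ∣ λ⟩`. -/
def Optic.id (A A' : C) : Optic M A A' A A' := Optic.mk (𝟙_ M) (λₗ A).inv (λₗ A').hom

/-- Representatives for `Optic₂`. -/
structure Optic₂Rep (S A : C) : Type (max u₁ v) where
  res₁ : M
  res₂ : M
  l : S ⟶ res₁ ⊙ₗ A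
  c : res₁ ⊙ₗ A ⟶ res₂ ⊙ₗ A
  r : res₂ ⊙ₗ A ⟶ S

/-- The relation generating the coend over `M × M`. -/
inductive Optic₂Rel (S A : C) : Optic₂Rep M S A → Optic₂Rep M S A → Prop
  | slide {m₁ m₂ n₁ n₂ : M} (f : m₁ ⟶ n₁) (g : m₂ ⟶ n₂) (l : S ⟶ m₁ ⊙ₗ A)
      (c : n₁ ⊙ₗ A ⟶ m₂ ⊙ₗ A) (r : n₂ ⊙ₗ A ⟶ S) :
      Optic₂Rel S A ⟨n₁, n₂, l ≫ f ⊵ₗ A, c ≫ g ⊵ₗ A, r⟩ ⟨m₁, m₂, l, f ⊵ₗ A ≫ c, g ⊵ₗ A ≫ r⟩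

/-- The coend `∫^{m₁, m₂ : M} C(S, m₁ ⬝ A) × C(m₁ ⬝ A, m₂ ⬝ A) × C(m₂ ⬝ A, S)`. -/
def Optic₂ (S A : C) : Type (max u₁ v) := Quot (Optic₂Rel M S A)

variable {M}

/-- The element `⟨l ∣ c ∣ r⟩` of `Optic₂ M S A`. -/
def Optic₂.mk {S A : C} (m₁ m₂ : M) (l : S ⟶ m₁ ⊙ₗ A) (c : m₁ ⊙ₗ A ⟶ m₂ ⊙ₗ A)
    (r : m₂ ⊙ₗ A ⟶ S) : Optic₂ M S A :=
  Quot.mk _ ⟨m₁, m₂, l, c, r⟩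

theorem Optic₂.slide {S A : C} {m₁ m₂ n₁ n₂ : M} (f : m₁ ⟶ n₁) (g : m₂ ⟶ n₂) (l : S ⟶ m₁ ⊙ₗ A)
    (c : n₁ ⊙ₗ A ⟶ m₂ ⊙ₗ A) (r : n₂ ⊙ₗ A ⟶ S) :
    Optic₂.mk n₁ n₂ (l ≫ f ⊵ₗ A) (c ≫ g ⊵ₗ A) r =
      Optic₂.mk m₁ m₂ l (f ⊵ₗ A ≫ c) (g ⊵ₗ A ≫ r) :=
  Quot.sound (Optic₂Rel.slide f g l c r)

namespace Optic

variable {S A : C}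

/-- `outside ⟨l ∣ r⟩ = l ≫ r`. -/
def outside : Optic M S S A A → (S ⟶ S) :=
  Optic.lift (fun _ l r => l ≫ r) (fun t l r => by simp)

/-- `once ⟨l ∣ r⟩ = ⟨l ∣ 𝟙 ∣ r⟩`. -/
def once : Optic M S S A A → Optic₂ M S A :=
  Optic.lift (fun m l r => Optic₂.mk m m l (𝟙 _) r) (fun {m n} t l r => by
    have h₁ := Optic₂.slide t (𝟙 n) l (𝟙 _) r
    have h₂ := Optic₂.slide (𝟙 m) t l (𝟙 _) r
    simp only [id_actionHomLeft, Category.id_comp, Category.comp_id] at h₁ h₂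
    exact h₁.trans h₂)

/-- `twice ⟨l ∣ r⟩ = ⟨l ∣ r ≫ l ∣ r⟩`. -/
def twice : Optic M S S A A → Optic₂ M S A :=
  Optic.lift (fun m l r => Optic₂.mk m m l (r ≫ l) r) (fun {m n} t l r => by
    have h := Optic₂.slide t t l (r ≫ l) r
    simpa only [Category.assoc] using h)

/-- An optic `S ⇸ A` is lawful if `outside p = 𝟙 S` and `once p = twice p`. -/
structure IsLawful (p : Optic M S S A A) : Prop where
  outside_eq : outside p = 𝟙 S
  once_eq_twice : once p = twice p

end Optic

end Optics

/-! ### Profunctors and their composition -/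

section Profunctors

variable {C : Type u} [Category.{v} C]

/-- The value `P(A, B)` of a profunctor, contravariant in `A` and covariant in `B`. -/
abbrev El (P : Profunctor.{w} C C) (A B : C) : Type w := (P.obj B).obj (op A)

/-- The functorial action `P(f, g) : P(A, B) → P(A', B')`. -/
def dimap (P : Profunctor.{w} C C) {A A' B B' : C} (f : A' ⟶ A) (g : B ⟶ B') (x : El P A B) :
    El P A' B' :=
  (P.map g).app (op A') ((P.obj B).map f.op x)

@[simp]
theorem dimap_id (P : Profunctor.{w} C C) {A B : C} (x : El P A B) :
    dimap P (𝟙 A) (𝟙 B) x = x := by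
  simp [dimap]

@[simp]
theorem dimap_dimap (P : Profunctor.{w} C C) {A A' A'' B B' B'' : C} (f : A' ⟶ A) (g : B ⟶ B')
    (f' : A'' ⟶ A') (g' : B' ⟶ B'') (x : El P A B) :
    dimap P f' g' (dimap P f g x) = dimap P (f' ≫ f) (g ≫ g') x := by
  simp [dimap, NatTrans.naturality_apply]

theorem dimap_ofCore (P : ProfunctorCore.{w} C C) {A A' B B' : C} (f : A' ⟶ A) (g : B ⟶ B')
    (x : P.obj B A) : dimap (Profunctor.ofCore P) f g x = P.map g f x := by
  rw [← P.map_lid_comp_map_rid]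
  rfl

/-- The component `P(A, B) → Q(A, B)` of a transformation of profunctors. -/
def ev {P Q : Profunctor.{w} C C} (t : P ⟶ Q) {A B : C} (x : El P A B) : El Q A B :=
  (t.app B).app (op A) x

@[simp]
theorem ev_dimap {P Q : Profunctor.{w} C C} (t : P ⟶ Q) {A A' B B' : C} (f : A' ⟶ A)
    (g : B ⟶ B') (x : El P A B) : ev t (dimap P f g x) = dimap Q f g (ev t x) := by
  have h₁ := NatTrans.naturality_apply (t.app B) f.op x
  have h₂ := congrArg (fun s => s.app (op A') ((P.obj B).map f.op x)) (t.naturality g)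
  simp only [ev, dimap, ← h₁]
  exact h₂

theorem prof_hom_ext {P Q : Profunctor.{w} C C} {s t : P ⟶ Q}
    (h : ∀ (A B : C) (x : El P A B), ev s x = ev t x) : s = t := by
  ext B A x
  exact h A.unop B x

/-- A transformation of profunctors from its components. -/
def mkHom {P Q : Profunctor.{w} C C} (φ : ∀ A B : C, El P A B → El Q A B)
    (h : ∀ {A A' B B' : C} (f : A' ⟶ A) (g : B ⟶ B') (x : El P A B),
      φ A' B' (dimap P f g x) = dimap Q f g (φ A B x)) : P ⟶ Q where
  app B :=
    { app A := ↾(φ A.unop B)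
      naturality A A' f := by
        ext x
        have := h f.unop (𝟙 B) x
        simpa [dimap] using this }
  naturality B B' g := by
    ext A x
    have := h (𝟙 A.unop) g x
    simpa [dimap] using this

@[simp]
theorem ev_mkHom {P Q : Profunctor.{w} C C} (φ : ∀ A B : C, El P A B → El Q A B)
    (h : ∀ {A A' B B' : C} (f : A' ⟶ A) (g : B ⟶ B') (x : El P A B),
      φ A' B' (dimap P f g x) = dimap Q f g (φ A B x)) {A B : C} (x : El P A B) :
    ev (mkHom φ h) x = φ A B x := rfl

@[simp]
theorem ev_id {P : Profunctor.{w} C C} {A B : C} (x : El P A B) : ev (𝟙 P) x = x := rfl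

@[simp]
theorem ev_comp {P Q R : Profunctor.{w} C C} (s : P ⟶ Q) (t : Q ⟶ R) {A B : C} (x : El P A B) :
    ev (s ≫ t) x = ev t (ev s x) := rfl

/-- The relation generating the coend `∫^Z P(A, Z) × Q(Z, B)`. -/
inductive CompRel (P Q : Profunctor.{w} C C) (A B : C) :
    (Σ Z : C, El P A Z × El Q Z B) → (Σ Z : C, El P A Z × El Q Z B) → Prop
  | slide {Z Z' : C} (h : Z ⟶ Z') (x : El P A Z) (y : El Q Z' B) :
      CompRel P Q A B ⟨Z', dimap P (𝟙 A) h x, y⟩ ⟨Z, x, dimap Q h (𝟙 B) y⟩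

/-- The composite profunctor `(P ⊙ Q)(A, B) = ∫^Z P(A, Z) × Q(Z, B)`, in diagrammatic order. -/
def comp (P Q : Profunctor.{w} C C) : Profunctor.{max u w} C C :=
  Profunctor.ofCore
    { obj B A := Quot (CompRel P Q A B)
      map {B B' A' A} g f := ↾(Quot.map
        (fun z => ⟨z.1, dimap P f (𝟙 _) z.2.1, dimap Q (𝟙 _) g z.2.2⟩) (by
          rintro _ _ ⟨h, x, y⟩
          have := CompRel.slide (P := P) (Q := Q) h (dimap P f (𝟙 _) x) (dimap Q (𝟙 _) g y)
          simpa using this))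
      map_id B A := by
        ext ⟨Z, x, y⟩
        simp [Quot.map]
      map_comp g g' f f' := by
        ext ⟨Z, x, y⟩
        simp [Quot.map] }

/-- The class in `(P ⊙ Q)(A, B)` of a pair in `P(A, Z) × Q(Z, B)`. -/
def comp.mk {P Q : Profunctor.{w} C C} {A B : C} (Z : C) (x : El P A Z) (y : El Q Z B) :
    El (comp P Q) A B :=
  Quot.mk (CompRel P Q A B) ⟨Z, x, y⟩

theorem comp.slide {P Q : Profunctor.{w} C C} {A B Z Z' : C} (h : Z ⟶ Z') (x : El P A Z)
    (y : El Q Z' B) : comp.mk Z' (dimap P (𝟙 A) h x) y = comp.mk Z x (dimap Q h (𝟙 B) y) :=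
  Quot.sound (CompRel.slide h x y)

theorem comp.ind {P Q : Profunctor.{w} C C} {A B : C} {motive : El (comp P Q) A B → Prop}
    (h : ∀ Z x y, motive (comp.mk Z x y)) (z : El (comp P Q) A B) : motive z :=
  Quot.ind (fun ⟨Z, x, y⟩ => h Z x y) z

/-- The universal property of the coend defining the composite. -/
def comp.lift {P Q : Profunctor.{w} C C} {A B : C} {X : Type*}
    (φ : ∀ Z : C, El P A Z → El Q Z B → X)
    (hφ : ∀ {Z Z' : C} (h : Z ⟶ Z') (x : El P A Z) (y : El Q Z' B),
      φ Z' (dimap P (𝟙 A) h x) y = φ Z x (dimap Q h (𝟙 B) y)) : El (comp P Q) A B → X :=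
  Quot.lift (fun z => φ z.1 z.2.1 z.2.2) (by rintro _ _ ⟨h, x, y⟩; exact hφ h x y)

@[simp]
theorem comp.lift_mk {P Q : Profunctor.{w} C C} {A B : C} {X : Type*}
    (φ : ∀ Z : C, El P A Z → El Q Z B → X)
    (hφ : ∀ {Z Z' : C} (h : Z ⟶ Z') (x : El P A Z) (y : El Q Z' B),
      φ Z' (dimap P (𝟙 A) h x) y = φ Z x (dimap Q h (𝟙 B) y)) (Z : C) (x : El P A Z)
    (y : El Q Z B) : comp.lift φ hφ (comp.mk Z x y) = φ Z x y := rfl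

@[simp]
theorem comp.dimap_mk {P Q : Profunctor.{w} C C} {A A' B B' Z : C} (f : A' ⟶ A) (g : B ⟶ B')
    (x : El P A Z) (y : El Q Z B) :
    dimap (comp P Q) f g (comp.mk Z x y) = comp.mk Z (dimap P f (𝟙 Z) x) (dimap Q (𝟙 Z) g y) :=
  dimap_ofCore _ f g _

end Profunctors

/-! ### Tambara modules -/

section Tambara

variable (M : Type u₁) [Category.{v₁} M] [MonoidalCategory M]
  (C : Type u) [Category.{v} C] [MonoidalLeftAction M C]

/-- A Tambara module for the action of `M` on `C`: a profunctor `P` on `C` with structure maps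
`ζ : P(A, B) → P(m ⬝ A, m ⬝ B)`. The profunctors take values in a universe that is large enough
for all the coends involved to exist. -/
structure Tambara where
  prof : Profunctor.{max w u v u₁} C C
  ζ (m : M) {A B : C} : El prof A B → El prof (m ⊙ₗ A) (m ⊙ₗ B)
  ζ_dimap (m : M) {A A' B B' : C} (f : A' ⟶ A) (g : B ⟶ B') (x : El prof A B) :
    ζ m (dimap prof f g x) = dimap prof (m ⊴ₗ f) (m ⊴ₗ g) (ζ m x)
  ζ_dinatural {m n : M} (t : m ⟶ n) {A B : C} (x : El prof A B) :
    dimap prof (𝟙 _) (t ⊵ₗ B) (ζ m x) = dimap prof (t ⊵ₗ A) (𝟙 _) (ζ n x)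
  ζ_tensor (n m : M) {A B : C} (x : El prof A B) :
    dimap prof (αₗ n m A).inv (αₗ n m B).hom (ζ (n ⊗ m) x) = ζ n (ζ m x)
  ζ_unit {A B : C} (x : El prof A B) :
    dimap prof (λₗ[M] A).inv (λₗ[M] B).hom (ζ (𝟙_ M) x) = x

namespace Tambara

variable {M C}

/-- Morphisms of Tambara modules: transformations that commute with the structure maps. -/
@[ext]
structure Hom (P Q : Tambara.{w} M C) where
  hom : P.prof ⟶ Q.prof
  ev_ζ (m : M) {A B : C} (x : El P.prof A B) : ev hom (P.ζ m x) = Q.ζ m (ev hom x)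

instance : Category.{max w u v u₁} (Tambara.{w} M C) where
  Hom P Q := Hom P Q
  id P := ⟨𝟙 P.prof, fun m A B x => rfl⟩
  comp s t := ⟨s.hom ≫ t.hom, fun m A B x => by simp [s.ev_ζ, t.ev_ζ]⟩

@[simp] theorem id_hom (P : Tambara.{w} M C) : Hom.hom (𝟙 P) = 𝟙 P.prof := rfl

@[simp] theorem comp_hom {P Q R : Tambara.{w} M C} (s : P ⟶ Q) (t : Q ⟶ R) :
    (s ≫ t).hom = s.hom ≫ t.hom := rfl

theorem ext_ev {P Q : Tambara.{w} M C} {s t : P ⟶ Q}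
    (h : ∀ (A B : C) (x : El P.prof A B), ev s.hom x = ev t.hom x) : s = t :=
  Hom.ext (prof_hom_ext h)

/-- Isomorphisms of Tambara modules from mutually inverse morphisms. -/
def mkIso {P Q : Tambara.{w} M C} (s : P ⟶ Q) (t : Q ⟶ P)
    (hst : ∀ (A B : C) (x : El P.prof A B), ev t.hom (ev s.hom x) = x)
    (hts : ∀ (A B : C) (x : El Q.prof A B), ev s.hom (ev t.hom x) = x) : P ≅ Q where
  hom := s
  inv := t
  hom_inv_id := ext_ev hst
  inv_hom_id := ext_ev hts

/-- The composite of Tambara modules, with `ζ [x, y] = [ζ x, ζ y]`. -/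
def tensor (P Q : Tambara.{w} M C) : Tambara.{w} M C where
  prof := comp P.prof Q.prof
  ζ m A B := comp.lift (fun Z x y => comp.mk (m ⊙ₗ Z) (P.ζ m x) (Q.ζ m y)) (by
    intro Z Z' h x y
    have := comp.slide (m ⊴ₗ h) (P.ζ m x) (Q.ζ m y)
    simpa [P.ζ_dimap, Q.ζ_dimap] using this)
  ζ_dimap m A A' B B' f g x := by
    induction x using comp.ind with
    | h Z x y => simp [P.ζ_dimap, Q.ζ_dimap]
  ζ_dinatural {m n} t A B x := by
    induction x using comp.ind with
    | h Z x y =>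
      have := comp.slide (t ⊵ₗ Z) (P.ζ m x) (Q.ζ n y)
      rw [P.ζ_dinatural, ← Q.ζ_dinatural] at this
      simpa using this.symm
  ζ_tensor n m A B x := by
    induction x using comp.ind with
    | h Z x y =>
      have := comp.slide (αₗ n m Z).hom (dimap P.prof (αₗ n m A).inv (𝟙 _) (P.ζ (n ⊗ m) x))
        (dimap Q.prof (αₗ n m Z).inv (αₗ n m B).hom (Q.ζ (n ⊗ m) y))
      simp only [dimap_dimap, Iso.hom_inv_id, Category.id_comp, Category.comp_id] at this
      rw [P.ζ_tensor, Q.ζ_tensor] at this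
      simpa using this.symm
  ζ_unit {A B} x := by
    induction x using comp.ind with
    | h Z x y =>
      have := comp.slide (λₗ[M] Z).hom (dimap P.prof (λₗ[M] A).inv (𝟙 _) (P.ζ (𝟙_ M) x))
        (dimap Q.prof (λₗ[M] Z).inv (λₗ[M] B).hom (Q.ζ (𝟙_ M) y))
      simp only [dimap_dimap, Iso.hom_inv_id, Category.id_comp, Category.comp_id] at this
      rw [P.ζ_unit, Q.ζ_unit] at this
      simpa using this.symm

/-- The class `[x, y]` in `(P ⊙ Q)(A, B)` of `x ∈ P(A, Z)` and `y ∈ Q(Z, B)`. -/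
def pair {P Q : Tambara.{w} M C} {A B : C} (Z : C) (x : El P.prof A Z) (y : El Q.prof Z B) :
    El (tensor P Q).prof A B :=
  comp.mk Z x y

theorem pair_slide {P Q : Tambara.{w} M C} {A B Z Z' : C} (h : Z ⟶ Z') (x : El P.prof A Z)
    (y : El Q.prof Z' B) :
    pair (P := P) (Q := Q) Z' (dimap P.prof (𝟙 A) h x) y = pair Z x (dimap Q.prof h (𝟙 B) y) :=
  comp.slide h x y

theorem pair_ind {P Q : Tambara.{w} M C} {A B : C} {motive : El (tensor P Q).prof A B → Prop}
    (h : ∀ Z x y, motive (pair Z x y)) (z : El (tensor P Q).prof A B) : motive z :=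
  comp.ind h z

/-- Functions out of `(P ⊙ Q)(A, B)`. -/
def pairLift {P Q : Tambara.{w} M C} {A B : C} {X : Type*}
    (φ : ∀ Z : C, El P.prof A Z → El Q.prof Z B → X)
    (hφ : ∀ {Z Z' : C} (h : Z ⟶ Z') (x : El P.prof A Z) (y : El Q.prof Z' B),
      φ Z' (dimap P.prof (𝟙 A) h x) y = φ Z x (dimap Q.prof h (𝟙 B) y)) :
    El (tensor P Q).prof A B → X :=
  comp.lift φ hφ

@[simp]
theorem pairLift_pair {P Q : Tambara.{w} M C} {A B : C} {X : Type*}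
    (φ : ∀ Z : C, El P.prof A Z → El Q.prof Z B → X)
    (hφ : ∀ {Z Z' : C} (h : Z ⟶ Z') (x : El P.prof A Z) (y : El Q.prof Z' B),
      φ Z' (dimap P.prof (𝟙 A) h x) y = φ Z x (dimap Q.prof h (𝟙 B) y)) (Z : C)
    (x : El P.prof A Z) (y : El Q.prof Z B) : pairLift φ hφ (pair Z x y) = φ Z x y := rfl

@[simp]
theorem ζ_pair (P Q : Tambara.{w} M C) (m : M) {A B Z : C} (x : El P.prof A Z)
    (y : El Q.prof Z B) :
    (tensor P Q).ζ m (pair Z x y) = pair (m ⊙ₗ Z) (P.ζ m x) (Q.ζ m y) := rfl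

@[simp]
theorem dimap_pair (P Q : Tambara.{w} M C) {A A' B B' Z : C} (f : A' ⟶ A) (g : B ⟶ B')
    (x : El P.prof A Z) (y : El Q.prof Z B) :
    dimap (tensor P Q).prof f g (pair Z x y) =
      pair Z (dimap P.prof f (𝟙 Z) x) (dimap Q.prof (𝟙 Z) g y) :=
  comp.dimap_mk f g x y

variable (M C) in
/-- The identity profunctor `C(-, =)`, with `ζ f = m ⬝ f`. -/
def unit : Tambara.{w} M C where
  prof := Profunctor.ulift.{max w u u₁} Profunctor.id
  ζ m A B x := ULift.up (m ⊴ₗ x.down)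
  ζ_dimap m A A' B B' f g x := ULift.ext _ _ <| by
    have h (k : A ⟶ B) : m ⊴ₗ ((f ≫ k) ≫ g) = (m ⊴ₗ f ≫ m ⊴ₗ k) ≫ m ⊴ₗ g := by simp
    exact h x.down
  ζ_dinatural {m n} t {A B} x := ULift.ext _ _ <| by
    have h (k : A ⟶ B) : (𝟙 _ ≫ m ⊴ₗ k) ≫ t ⊵ₗ B = (t ⊵ₗ A ≫ n ⊴ₗ k) ≫ 𝟙 _ := by
      rw [Category.id_comp, Category.comp_id, action_exchange]
    exact h x.down
  ζ_tensor n m {A B} x := ULift.ext _ _ <| by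
    have h (k : A ⟶ B) : ((αₗ n m A).inv ≫ (n ⊗ m) ⊴ₗ k) ≫ (αₗ n m B).hom = n ⊴ₗ m ⊴ₗ k := by
      simp
    exact h x.down
  ζ_unit {A B} x := ULift.ext _ _ <| by
    have h (k : A ⟶ B) : ((λₗ[M] A).inv ≫ (𝟙_ M) ⊴ₗ k) ≫ (λₗ[M] B).hom = k := by simp
    exact h x.down

/-- A morphism `A ⟶ B` as an element of the identity profunctor. -/
def ofHom {A B : C} (f : A ⟶ B) : El (unit.{w} M C).prof A B := ULift.up f

/-- An element of the identity profunctor as a morphism `A ⟶ B`. -/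
def toHom {A B : C} (x : El (unit.{w} M C).prof A B) : A ⟶ B := x.down

@[simp] theorem toHom_ofHom {A B : C} (f : A ⟶ B) : toHom (ofHom.{w} (M := M) f) = f := rfl

@[simp] theorem ofHom_toHom {A B : C} (x : El (unit.{w} M C).prof A B) : ofHom (toHom x) = x := rfl

@[simp]
theorem unit_ζ (m : M) {A B : C} (x : El (unit.{w} M C).prof A B) :
    (unit.{w} M C).ζ m x = ofHom (m ⊴ₗ toHom x) := rfl

@[simp]
theorem unit_dimap {A A' B B' : C} (f : A' ⟶ A) (g : B ⟶ B') (x : El (unit.{w} M C).prof A B) :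
    dimap (unit.{w} M C).prof f g x = ofHom (f ≫ toHom x ≫ g) :=
  ULift.ext _ _ (Category.assoc f x.down g)

/-- The product of two morphisms: `[x, y] ↦ [s x, t y]`. -/
def tensorMap {P P' Q Q' : Tambara.{w} M C} (s : P ⟶ P') (t : Q ⟶ Q') :
    tensor P Q ⟶ tensor P' Q' where
  hom := mkHom (P := (tensor P Q).prof) (Q := (tensor P' Q').prof)
    (fun A B => pairLift (fun Z x y => pair Z (ev s.hom x) (ev t.hom y)) (by
      intro Z Z' h x y
      simpa using pair_slide h (ev s.hom x) (ev t.hom y))) (by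
      intro A A' B B' f g x
      induction x using pair_ind with
      | h Z x y => simp)
  ev_ζ m A B x := by
    induction x using pair_ind with
    | h Z x y => simp [s.ev_ζ, t.ev_ζ]

@[simp]
theorem tensorMap_mk {P P' Q Q' : Tambara.{w} M C} (s : P ⟶ P') (t : Q ⟶ Q') {A B Z : C}
    (x : El P.prof A Z) (y : El Q.prof Z B) :
    ev (tensorMap s t).hom (pair Z x y) = pair Z (ev s.hom x) (ev t.hom y) := rfl

/-- `[[x, y], z] ↦ [x, [y, z]]`. -/
def assocHom (P Q R : Tambara.{w} M C) : tensor (tensor P Q) R ⟶ tensor P (tensor Q R) where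
  hom := mkHom (P := (tensor (tensor P Q) R).prof) (Q := (tensor P (tensor Q R)).prof)
    (fun A B => pairLift (fun Z xy z => pairLift
        (fun Y x y => pair Y x (pair Z y z)) (by
          intro Y Y' h x y
          simpa using pair_slide h x (pair (P := Q) (Q := R) Z y z)) xy) (by
      intro Z Z' h xy z
      induction xy using pair_ind with
      | h Y x y => simp [pair_slide])) (by
      intro A A' B B' f g x
      induction x using pair_ind with
      | h Z xy z =>
        induction xy using pair_ind with
        | h Y x y => simp)
  ev_ζ m A B x := by
    induction x using pair_ind with
    | h Z xy z =>
      induction xy using pair_ind with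
      | h Y x y => rfl

@[simp]
theorem assocHom_mk (P Q R : Tambara.{w} M C) {A B Y Z : C} (x : El P.prof A Y)
    (y : El Q.prof Y Z) (z : El R.prof Z B) :
    ev (assocHom P Q R).hom (pair Z (pair Y x y) z) = pair Y x (pair Z y z) := rfl

/-- `[x, [y, z]] ↦ [[x, y], z]`. -/
def assocInv (P Q R : Tambara.{w} M C) : tensor P (tensor Q R) ⟶ tensor (tensor P Q) R where
  hom := mkHom (P := (tensor P (tensor Q R)).prof) (Q := (tensor (tensor P Q) R).prof)
    (fun A B => pairLift (fun Y x yz => pairLift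
        (fun Z y z => pair Z (pair Y x y) z) (by
          intro Z Z' h y z
          simpa using pair_slide h (pair (P := P) (Q := Q) Y x y) z) yz) (by
      intro Y Y' h x yz
      induction yz using pair_ind with
      | h Z y z =>
        simp only [dimap_pair, dimap_id]
        exact congrArg (fun t => pair Z t z) (pair_slide h x y))) (by
      intro A A' B B' f g x
      induction x using pair_ind with
      | h Y x yz =>
        induction yz using pair_ind with
        | h Z y z => simp)
  ev_ζ m A B x := by
    induction x using pair_ind with
    | h Y x yz =>
      induction yz using pair_ind with
      | h Z y z => rfl

@[simp]
theorem assocInv_mk (P Q R : Tambara.{w} M C) {A B Y Z : C} (x : El P.prof A Y)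
    (y : El Q.prof Y Z) (z : El R.prof Z B) :
    ev (assocInv P Q R).hom (pair Y x (pair Z y z)) = pair Z (pair Y x y) z := rfl

/-- `[f, x] ↦ P(f, 𝟙) x`. -/
def leftHom (P : Tambara.{w} M C) : tensor (unit M C) P ⟶ P where
  hom := mkHom (P := (tensor (unit M C) P).prof)
    (fun A B => pairLift (fun Z f x => dimap P.prof (toHom f) (𝟙 B) x) (by
      intro Z Z' h f x
      simp)) (by
      intro A A' B B' f g x
      induction x using pair_ind with
      | h Z k x =>
        simp)
  ev_ζ m A B x := by
    induction x using pair_ind with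
    | h Z k x =>
      simp [P.ζ_dimap]

@[simp]
theorem leftHom_mk (P : Tambara.{w} M C) {A B Z : C}
    (k : El (unit M C).prof A Z) (x : El P.prof Z B) :
    ev (leftHom P).hom (pair Z k x) = dimap P.prof (toHom k) (𝟙 B) x := rfl

/-- `x ↦ [𝟙, x]`. -/
def leftInv (P : Tambara.{w} M C) : P ⟶ tensor (unit M C) P where
  hom := mkHom (Q := (tensor (unit M C) P).prof)
    (fun A B x => pair A (ofHom (𝟙 A)) x) (by
      intro A A' B B' f g x
      have := pair_slide (P := unit.{w} M C) f (ofHom (𝟙 A')) (dimap P.prof (𝟙 A) g x)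
      simpa using this.symm)
  ev_ζ m A B x := by simp

@[simp]
theorem leftInv_apply (P : Tambara.{w} M C) {A B : C} (x : El P.prof A B) :
    ev (leftInv P).hom x = pair A (ofHom (𝟙 A)) x := rfl

/-- `[x, f] ↦ P(𝟙, f) x`. -/
def rightHom (P : Tambara.{w} M C) : tensor P (unit M C) ⟶ P where
  hom := mkHom (P := (tensor P (unit M C)).prof)
    (fun A B => pairLift (fun Z x f => dimap P.prof (𝟙 A) (toHom f) x) (by
      intro Z Z' h x f
      simp)) (by
      intro A A' B B' f g x
      induction x using pair_ind with
      | h Z x k =>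
        simp)
  ev_ζ m A B x := by
    induction x using pair_ind with
    | h Z x k =>
      simp [P.ζ_dimap]

@[simp]
theorem rightHom_mk (P : Tambara.{w} M C) {A B Z : C} (x : El P.prof A Z)
    (k : El (unit M C).prof Z B) :
    ev (rightHom P).hom (pair Z x k) = dimap P.prof (𝟙 A) (toHom k) x := rfl

/-- `x ↦ [x, 𝟙]`. -/
def rightInv (P : Tambara.{w} M C) : P ⟶ tensor P (unit M C) where
  hom := mkHom (Q := (tensor P (unit M C)).prof)
    (fun A B x => pair B x (ofHom (𝟙 B))) (by
      intro A A' B B' f g x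
      have := pair_slide (Q := unit.{w} M C) g (dimap P.prof f (𝟙 B) x) (ofHom (𝟙 B'))
      simpa using this)
  ev_ζ m A B x := by simp

@[simp]
theorem rightInv_apply (P : Tambara.{w} M C) {A B : C} (x : El P.prof A B) :
    ev (rightInv P).hom x = pair B x (ofHom (𝟙 B)) := rfl

/-- The data of the monoidal structure on Tambara modules given by composition. -/
instance : MonoidalCategoryStruct (Tambara.{w} M C) where
  tensorObj := tensor
  tensorUnit := unit M C
  tensorHom := tensorMap
  whiskerLeft P _ _ t := tensorMap (𝟙 P) t
  whiskerRight s Q := tensorMap s (𝟙 Q)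
  associator P Q R := mkIso (assocHom P Q R) (assocInv P Q R)
    (by
      intro A B x
      induction x using pair_ind with
      | h Z xy z =>
        induction xy using pair_ind with
        | h Y x y => rfl)
    (by
      intro A B x
      induction x using pair_ind with
      | h Y x yz =>
        induction yz using pair_ind with
        | h Z y z => rfl)
  leftUnitor P := mkIso (leftHom P) (leftInv P)
    (by
      intro A B x
      induction x using pair_ind with
      | h Z k x =>
        simp)
    (by intro A B x; simp)
  rightUnitor P := mkIso (rightHom P) (rightInv P)
    (by
      intro A B x
      induction x using pair_ind with
      | h Z x k =>
        simp)
    (by intro A B x; simp)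

@[simp]
theorem ev_tensorHom {P P' Q Q' : Tambara.{w} M C} (s : P ⟶ P') (t : Q ⟶ Q') {A B Z : C}
    (x : El P.prof A Z) (y : El Q.prof Z B) :
    ev (s ⊗ₘ t).hom (pair Z x y) = pair Z (ev s.hom x) (ev t.hom y) := rfl

@[simp]
theorem ev_whiskerLeft (P : Tambara.{w} M C) {Q Q' : Tambara.{w} M C} (t : Q ⟶ Q') {A B Z : C}
    (x : El P.prof A Z) (y : El Q.prof Z B) :
    ev (P ◁ t).hom (pair Z x y) = pair Z x (ev t.hom y) := rfl

@[simp]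
theorem ev_whiskerRight {P P' : Tambara.{w} M C} (s : P ⟶ P') (Q : Tambara.{w} M C) {A B Z : C}
    (x : El P.prof A Z) (y : El Q.prof Z B) :
    ev (s ▷ Q).hom (pair Z x y) = pair Z (ev s.hom x) y := rfl

@[simp]
theorem ev_associator_hom (P Q R : Tambara.{w} M C) {A B Y Z : C} (x : El P.prof A Y)
    (y : El Q.prof Y Z) (z : El R.prof Z B) :
    ev (α_ P Q R).hom.hom (pair Z (pair Y x y) z) = pair Y x (pair Z y z) := rfl

@[simp]
theorem ev_leftUnitor_hom (P : Tambara.{w} M C) {A B Z : C}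
    (k : El (unit M C).prof A Z) (x : El P.prof Z B) :
    ev (λ_ P).hom.hom (pair Z k x) = dimap P.prof (toHom k) (𝟙 B) x := rfl

@[simp]
theorem ev_leftUnitor_inv (P : Tambara.{w} M C) {A B : C} (x : El P.prof A B) :
    ev (λ_ P).inv.hom x = pair A (ofHom (𝟙 A)) x := rfl

@[simp]
theorem ev_rightUnitor_hom (P : Tambara.{w} M C) {A B Z : C} (x : El P.prof A Z)
    (k : El (unit M C).prof Z B) :
    ev (ρ_ P).hom.hom (pair Z x k) = dimap P.prof (𝟙 A) (toHom k) x := rfl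

@[simp]
theorem ev_rightUnitor_inv (P : Tambara.{w} M C) {A B : C} (x : El P.prof A B) :
    ev (ρ_ P).inv.hom x = pair B x (ofHom (𝟙 B)) := rfl

/-- Tambara modules form a monoidal category under composition of profunctors. -/
instance : MonoidalCategory (Tambara.{w} M C) :=
  MonoidalCategory.ofTensorHom
    (id_tensorHom_id := by
      intro P Q
      apply ext_ev
      intro A B x
      induction x using pair_ind with
      | h Z x y => rfl)
    (id_tensorHom := by intros; rfl)
    (tensorHom_id := by intros; rfl)
    (tensorHom_comp_tensorHom := by
      intros
      apply ext_ev
      intro A B x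
      induction x using pair_ind with
      | h Z x y => rfl)
    (associator_naturality := by
      intros
      apply ext_ev
      intro A B x
      induction x using pair_ind with
      | h Z xy z =>
        induction xy using pair_ind with
        | h Y x y => rfl)
    (leftUnitor_naturality := by
      intro P Q t
      apply ext_ev
      intro A B x
      induction x using pair_ind with
      | h Z k x =>
        exact (ev_dimap t.hom (toHom k) (𝟙 B) x).symm)
    (rightUnitor_naturality := by
      intro P Q t
      apply ext_ev
      intro A B x
      induction x using pair_ind with
      | h Z x k =>
        exact (ev_dimap t.hom (𝟙 A) (toHom k) x).symm)
    (pentagon := by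
      intro P Q R S
      apply ext_ev
      intro A B x
      induction x using pair_ind with
      | h Z xyz t =>
        induction xyz using pair_ind with
        | h Y xy z =>
          induction xy using pair_ind with
          | h X x y => rfl)
    (triangle := by
      intro P Q
      apply ext_ev
      intro A B x
      induction x using pair_ind with
      | h Z xk y =>
        induction xk using pair_ind with
        | h Y x k =>
            
          have := pair_slide (P := P) (Q := Q) (toHom k) x y
          exact this.symm)


/-! ### The Tambara modules `Φ E_{A, A'}` and their comonoid structure -/

variable (M) in
/-- The profunctor underlying `Φ E_{A, A'}`: its value at `(X, Y)` is the set of optics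
`(X, Y) ⇸ (A, A')`. -/
def freeProf (A A' : C) : Profunctor.{max w u v u₁} C C :=
  Profunctor.ofCore
    { obj Y X := ULift.{max w u} (Optic M X Y A A')
      map {Y Y' X' X} g f := ↾(fun p => ULift.up (Optic.map f g p.down))
      map_id Y X := by
        ext ⟨p⟩
        change Optic.map (𝟙 X) (𝟙 Y) p = p
        induction p using Optic.ind with
        | h m l r => simp
      map_comp g g' f f' := by
        ext ⟨p⟩
        change Optic.map (f ≫ f') (g ≫ g') p = Optic.map f g' (Optic.map f' g p)
        induction p using Optic.ind with
        | h m l r => simp }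

theorem dimap_freeProf {A A' X X' Y Y' : C} (f : X' ⟶ X) (g : Y ⟶ Y') (p : Optic M X Y A A') :
    dimap (freeProf.{w} M A A') f g (ULift.up p) = ULift.up (Optic.map f g p) :=
  dimap_ofCore _ f g _

/-- The Tambara module `Φ E_{A, A'}` freely generated by the exchange profunctor
`E_{A, A'} = C(-, A) × C(A', =)`. Its values are sets of optics, with `ζ ⟨l ∣ r⟩ = ⟨n ⬝ l ∣ n ⬝ r⟩`
for `n : M`. -/
def free (A A' : C) : Tambara.{w} M C where
  prof := freeProf M A A'
  ζ n _ _ p := ULift.up (Optic.act n p.down)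
  ζ_dimap n _ _ _ _ f g p :=
    (congrArg (fun q : ULift _ => ULift.up (Optic.act n q.down)) (dimap_freeProf f g p.down)).trans
      ((congrArg ULift.up (Optic.act_map n f g p.down)).trans (dimap_freeProf _ _ _).symm)
  ζ_dinatural t _ _ p :=
    (dimap_freeProf _ _ _).trans
      ((congrArg ULift.up (Optic.act_dinatural t p.down)).trans (dimap_freeProf _ _ _).symm)
  ζ_tensor n n' _ _ p :=
    (dimap_freeProf _ _ _).trans (congrArg ULift.up (Optic.act_tensor n n' p.down))
  ζ_unit p :=
    (dimap_freeProf _ _ _).trans (congrArg ULift.up (Optic.act_unit p.down))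

/-- The optic `⟨l ∣ r⟩` as an element of `Φ E_{A, A'}(X, Y)`. -/
def rep {A A' X Y : C} (m : M) (l : X ⟶ m ⊙ₗ A) (r : m ⊙ₗ A' ⟶ Y) :
    El (free.{w} (M := M) A A').prof X Y :=
  ULift.up (Optic.mk m l r)

theorem rep_slide {A A' X Y : C} {m n : M} (t : m ⟶ n) (l : X ⟶ m ⊙ₗ A) (r : n ⊙ₗ A' ⟶ Y) :
    rep.{w} n (l ≫ t ⊵ₗ A) r = rep m l (t ⊵ₗ A' ≫ r) :=
  congrArg ULift.up (Optic.slide t l r)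

theorem rep_ind {A A' X Y : C} {motive : El (free.{w} (M := M) A A').prof X Y → Prop}
    (h : ∀ m l r, motive (rep m l r)) (p : El (free.{w} (M := M) A A').prof X Y) : motive p :=
  Optic.ind (motive := fun p => motive (ULift.up p)) h p.down

/-- Functions out of `Φ E_{A, A'}(X, Y)`. -/
def repLift {A A' X Y : C} {Z : Type*} (f : ∀ m : M, (X ⟶ m ⊙ₗ A) → (m ⊙ₗ A' ⟶ Y) → Z)
    (h : ∀ {m n : M} (t : m ⟶ n) (l : X ⟶ m ⊙ₗ A) (r : n ⊙ₗ A' ⟶ Y),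
      f n (l ≫ t ⊵ₗ A) r = f m l (t ⊵ₗ A' ≫ r)) (p : El (free.{w} (M := M) A A').prof X Y) : Z :=
  Optic.lift f h p.down

@[simp]
theorem repLift_rep {A A' X Y : C} {Z : Type*} (f : ∀ m : M, (X ⟶ m ⊙ₗ A) → (m ⊙ₗ A' ⟶ Y) → Z)
    (h : ∀ {m n : M} (t : m ⟶ n) (l : X ⟶ m ⊙ₗ A) (r : n ⊙ₗ A' ⟶ Y),
      f n (l ≫ t ⊵ₗ A) r = f m l (t ⊵ₗ A' ≫ r)) (m : M) (l : X ⟶ m ⊙ₗ A) (r : m ⊙ₗ A' ⟶ Y) :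
    repLift.{w} f h (rep m l r) = f m l r := rfl

@[simp]
theorem dimap_rep {A A' X X' Y Y' : C} (f : X' ⟶ X) (g : Y ⟶ Y') (m : M) (l : X ⟶ m ⊙ₗ A)
    (r : m ⊙ₗ A' ⟶ Y) :
    dimap (free.{w} (M := M) A A').prof f g (rep m l r) = rep m (f ≫ l) (r ≫ g) :=
  dimap_freeProf f g _

@[simp]
theorem ζ_rep {A A' X Y : C} (n m : M) (l : X ⟶ m ⊙ₗ A) (r : m ⊙ₗ A' ⟶ Y) :
    (free.{w} (M := M) A A').ζ n (rep m l r) =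
      rep (n ⊗ m) (n ⊴ₗ l ≫ (αₗ n m A).inv) ((αₗ n m A').hom ≫ n ⊴ₗ r) := rfl

/-- The counit `⟨l ∣ r⟩ ↦ l ≫ r` of `Φ E_A`. -/
def freeCounit (A : C) : free.{w} (M := M) A A ⟶ 𝟙_ (Tambara.{w} M C) where
  hom := mkHom (P := (free.{w} (M := M) A A).prof) (Q := (unit.{w} M C).prof)
    (fun X Y => repLift (fun m l r => ofHom (l ≫ r)) (fun t l r => by simp)) (by
      intro X X' Y Y' f g p
      induction p using rep_ind with
      | h m l r => simp)
  ev_ζ n X Y p := by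
    induction p using rep_ind with
    | h m l r =>
      change ofHom ((n ⊴ₗ l ≫ (αₗ n m A).inv) ≫ (αₗ n m A).hom ≫ n ⊴ₗ r) =
        ofHom (n ⊴ₗ (l ≫ r))
      simp

@[simp]
theorem ev_freeCounit {A X Y : C} (m : M) (l : X ⟶ m ⊙ₗ A) (r : m ⊙ₗ A ⟶ Y) :
    ev (freeCounit A).hom (rep.{w} m l r) = ofHom (l ≫ r) := rfl

/-- The comultiplication `⟨l ∣ r⟩ ↦ ⟨l ∣ 𝟙 ∣ r⟩ = [⟨l ∣ 𝟙⟩, ⟨𝟙 ∣ r⟩]` of `Φ E_A`. -/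
def freeComul (A : C) :
    free.{w} (M := M) A A ⟶ free.{w} (M := M) A A ⊗ free.{w} (M := M) A A where
  hom := mkHom (P := (free.{w} (M := M) A A).prof)
    (Q := (tensor (free.{w} (M := M) A A) (free.{w} (M := M) A A)).prof)
    (fun X Y => repLift (fun m l r => pair (m ⊙ₗ A) (rep m l (𝟙 _)) (rep m (𝟙 _) r))
      (fun {m n} t l r => by
        have h := pair_slide (P := free.{w} (M := M) A A) (Q := free.{w} (M := M) A A) (t ⊵ₗ A)
          (rep m l (𝟙 _)) (rep n (𝟙 _) r)
        have h₁ := rep_slide.{w} t l (𝟙 (n ⊙ₗ A))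
        have h₂ := rep_slide.{w} t (𝟙 (m ⊙ₗ A)) r
        simp only [dimap_rep, Category.id_comp, Category.comp_id] at h h₁ h₂
        rw [h₁, h, h₂])) (by
      intro X X' Y Y' f g p
      induction p using rep_ind with
      | h m l r => simp)
  ev_ζ n X Y p := by
    induction p using rep_ind with
    | h m l r =>
      have h := pair_slide (P := free.{w} (M := M) A A) (Q := free.{w} (M := M) A A)
        (αₗ n m A).hom (rep (n ⊗ m) (n ⊴ₗ l ≫ (αₗ n m A).inv) (𝟙 _))
        (rep (n ⊗ m) (αₗ n m A).inv ((αₗ n m A).hom ≫ n ⊴ₗ r))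
      change pair ((n ⊗ m) ⊙ₗ A) (rep (n ⊗ m) (n ⊴ₗ l ≫ (αₗ n m A).inv) (𝟙 _))
          (rep (n ⊗ m) (𝟙 _) ((αₗ n m A).hom ≫ n ⊴ₗ r)) =
        pair (n ⊙ₗ m ⊙ₗ A) ((free A A).ζ n (rep m l (𝟙 _))) ((free A A).ζ n (rep m (𝟙 _) r))
      simpa using h.symm

@[simp]
theorem ev_freeComul {A X Y : C} (m : M) (l : X ⟶ m ⊙ₗ A) (r : m ⊙ₗ A ⟶ Y) :
    ev (freeComul A).hom (rep.{w} m l r) = pair (m ⊙ₗ A) (rep m l (𝟙 _)) (rep m (𝟙 _) r) := rfl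

/-- The comonoid structure on `Φ E_A`. -/
instance (A : C) : ComonObj (free.{w} (M := M) A A) where
  counit := freeCounit A
  comul := freeComul A
  counit_comul := by
    apply ext_ev
    intro X Y p
    induction p using rep_ind with
    | h m l r =>
      have h := pair_slide (P := unit.{w} M C) (Q := free.{w} (M := M) A A) l (ofHom (𝟙 X))
        (rep m (𝟙 _) r)
      simpa using h
  comul_counit := by
    apply ext_ev
    intro X Y p
    induction p using rep_ind with
    | h m l r =>
      have h := pair_slide (P := free.{w} (M := M) A A) (Q := unit.{w} M C) r
        (rep m l (𝟙 _)) (ofHom (𝟙 Y))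
      simpa using h.symm
  comul_assoc := by
    apply ext_ev
    intro X Y p
    induction p using rep_ind with
    | h m l r => simp

/-! ### Evaluation of Tambara modules and profunctor optics -/

variable (M) in
/-- The functor `(U-)(A, A') : Tamb ⥤ Set`. -/
def evalAt (A A' : C) : Tambara.{w} M C ⥤ Type (max w u v u₁) where
  obj P := El P.prof A A'
  map s := ↾(ev s.hom)

/-- The morphism `Φ E_{A, A'} ⟶ P` that corresponds to an element of `P(A, A')`. -/
def ofEl {P : Tambara.{w} M C} {A A' : C} (x : El P.prof A A') : free A A' ⟶ P where
  hom := mkHom (P := (free.{w} (M := M) A A').prof)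
    (fun X Y => repLift (fun m l r => dimap P.prof l r (P.ζ m x)) (fun {m n} t l r => by
      have := congrArg (dimap P.prof l r) (P.ζ_dinatural t x)
      simpa using this.symm)) (by
      intro X X' Y Y' f g p
      induction p using rep_ind with
      | h m l r => simp)
  ev_ζ n X Y p := by
    induction p using rep_ind with
    | h m l r =>
      simp [P.ζ_dimap, ← P.ζ_tensor]

@[simp]
theorem ev_ofEl {P : Tambara.{w} M C} {A A' X Y : C} (x : El P.prof A A') (m : M)
    (l : X ⟶ m ⊙ₗ A) (r : m ⊙ₗ A' ⟶ Y) :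
    ev (ofEl x).hom (rep m l r) = dimap P.prof l r (P.ζ m x) := rfl

variable (M) in
/-- The identity optic as an element of `Φ E_{A, A'}(A, A')`. -/
def idEl (A A' : C) : El (free.{w} (M := M) A A').prof A A' := ULift.up (Optic.id M A A')

theorem dimap_ζ_idEl {A A' X Y : C} (m : M) (l : X ⟶ m ⊙ₗ A) (r : m ⊙ₗ A' ⟶ Y) :
    dimap (free.{w} (M := M) A A').prof l r ((free A A').ζ m (idEl M A A')) = rep m l r := by
  have h := rep_slide.{w} (ρ_ m).hom (l ≫ m ⊴ₗ (λₗ[M] A).inv ≫ (αₗ m (𝟙_ M) A).inv) r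
  rw [rightUnitor_actionHom, rightUnitor_actionHom] at h
  have e : idEl.{w} M A A' = rep (𝟙_ M) (λₗ A).inv (λₗ A').hom := rfl
  simpa [e] using h.symm

/-- `Φ E_{A, A'}` represents `(U-)(A, A')`, through evaluation at the identity optic. -/
def representation (A A' : C) :
    coyoneda.obj (op (free.{w} (M := M) A A')) ≅ evalAt.{w} M A A' :=
  NatIso.ofComponents
    (fun P => Equiv.toIso
      { toFun := fun s => ev s.hom (idEl M A A')
        invFun := fun x => ofEl x
        left_inv := fun s => by
          apply ext_ev
          intro X Y p
          induction p using rep_ind with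
          | h m l r => 
            rw [ev_ofEl, ← Hom.ev_ζ, ← ev_dimap, dimap_ζ_idEl]
        right_inv := fun x => P.ζ_unit x })
    (by intros; rfl)

/-- Profunctor optics are optics: an optic `p : (S, S') ⇸ (A, A')` corresponds under the Yoneda
lemma to a natural transformation `(U-)(A, A') ⟶ (U-)(S, S')`. -/
def profunctorOptic {S S' A A' : C} :
    Optic M S S' A A' ≃ (evalAt.{w} M A A' ⟶ evalAt.{w} M S S') :=
  Equiv.ulift.symm.trans <|
    (coyonedaEquiv (X := free.{w} (M := M) A A') (F := evalAt.{w} M S S')).symm.trans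
      ((representation A A').homCongr (Iso.refl _))

/-- Explicitly, the natural transformation is `x ↦ P(l, r) (ζ x)`. -/
theorem profunctorOptic_mk {S S' A A' : C} (m : M) (l : S ⟶ m ⊙ₗ A) (r : m ⊙ₗ A' ⟶ S')
    (P : Tambara.{w} M C) (x : El P.prof A A') :
    (profunctorOptic.{w} (Optic.mk m l r)).app P x = dimap P.prof l r (P.ζ m x) := rfl

end Tambara

end Tambara

/-! ### The canonical lax monoidal structures -/

section Lax

/-- The lax monoidal structure on `D(X, -)` for a comonoid `X`. -/
@[reducible]
def laxCoyoneda {D : Type u} [Category.{v} D] [MonoidalCategory D] (X : D) [ComonObj X] :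
    (coyoneda.obj (op X)).LaxMonoidal :=
  Functor.LaxMonoidal.ofTensorHom
    (ε := ↾fun _ => ComonObj.counit)
    (μ := fun Y Z => ↾fun p => ComonObj.comul ≫ (p.1 ⊗ₘ p.2))
    (μ_natural := by
      intro Y Z Y' Z' s t
      ext ⟨f, g⟩
      change ComonObj.comul ≫ (f ≫ s ⊗ₘ g ≫ t) = (ComonObj.comul ≫ (f ⊗ₘ g)) ≫ (s ⊗ₘ t)
      simp)
    (associativity := fun Y Z W => by
      ext ⟨⟨f, g⟩, h⟩
      change (ComonObj.comul ≫ ((ComonObj.comul ≫ (f ⊗ₘ g)) ⊗ₘ h)) ≫ (α_ Y Z W).hom =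
        ComonObj.comul ≫ (f ⊗ₘ (ComonObj.comul ≫ (g ⊗ₘ h)))
      rw [← Category.id_comp h, ← tensorHom_comp_tensorHom, Category.id_comp, Category.assoc,
        Category.assoc, associator_naturality, tensorHom_id, ← ComonObj.comul_assoc_assoc]
      nth_rewrite 2 [← Category.id_comp f]
      rw [← tensorHom_comp_tensorHom, id_tensorHom])
    (left_unitality := fun Y => by
      ext ⟨⟨⟩, f⟩
      change f = (ComonObj.comul ≫ (ComonObj.counit ⊗ₘ f)) ≫ (λ_ Y).hom
      rw [MonoidalCategory.tensorHom_def]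
      simp)
    (right_unitality := fun Y => by
      ext ⟨f, ⟨⟩⟩
      change f = (ComonObj.comul ≫ (f ⊗ₘ ComonObj.counit)) ≫ (ρ_ Y).hom
      rw [MonoidalCategory.tensorHom_def']
      simp)

/-- Transport of a lax monoidal structure along a natural isomorphism. -/
@[reducible]
def laxTransport {D : Type u} [Category.{v} D] [MonoidalCategory D] {E : Type u₁}
    [Category.{v₁} E] [MonoidalCategory E] {F G : D ⥤ E} (hF : F.LaxMonoidal) (e : F ≅ G) :
    G.LaxMonoidal :=
  Functor.LaxMonoidal.ofTensorHom
    (ε := hF.ε ≫ e.hom.app _)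
    (μ := fun X Y => (e.inv.app X ⊗ₘ e.inv.app Y) ≫ hF.μ X Y ≫ e.hom.app _)
    (μ_natural := by
      intro X Y X' Y' f g
      rw [tensorHom_comp_tensorHom_assoc, e.inv.naturality, e.inv.naturality,
        ← tensorHom_comp_tensorHom_assoc, Functor.LaxMonoidal.μ_natural_assoc]
      simp)
    (associativity := fun X Y Z => by
      have h := hF.associativity X Y Z
      rw [← tensorHom_id, ← id_tensorHom] at h
      simp only [Category.assoc]
      rw [tensorHom_comp_tensorHom_assoc, tensorHom_comp_tensorHom_assoc]
      simp only [Category.assoc, Category.id_comp, Iso.hom_inv_id_app, Category.comp_id]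
      have h₁ : (e.inv.app X ⊗ₘ e.inv.app Y) ≫ hF.μ X Y ⊗ₘ e.inv.app Z =
          ((e.inv.app X ⊗ₘ e.inv.app Y) ⊗ₘ e.inv.app Z) ≫ (hF.μ X Y ⊗ₘ 𝟙 _) := by
        rw [tensorHom_comp_tensorHom, Category.comp_id]
      have h₂ : e.inv.app X ⊗ₘ (e.inv.app Y ⊗ₘ e.inv.app Z) ≫ hF.μ Y Z =
          (e.inv.app X ⊗ₘ (e.inv.app Y ⊗ₘ e.inv.app Z)) ≫ (𝟙 _ ⊗ₘ hF.μ Y Z) := by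
        rw [tensorHom_comp_tensorHom, Category.comp_id]
      rw [h₁, h₂, ← e.hom.naturality]
      simp only [Category.assoc]
      rw [reassoc_of% h, associator_naturality_assoc])
    (left_unitality := fun X => by
      simp only [Category.assoc]
      rw [tensorHom_comp_tensorHom_assoc]
      have h₁ : (hF.ε ≫ e.hom.app _) ≫ e.inv.app _ ⊗ₘ 𝟙 (G.obj X) ≫ e.inv.app X =
          (𝟙 _ ⊗ₘ e.inv.app X) ≫ (hF.ε ▷ F.obj X) := by
        rw [← tensorHom_id, tensorHom_comp_tensorHom]
        simp
      rw [h₁]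
      simp only [Category.assoc]
      rw [← e.hom.naturality, ← reassoc_of% (hF.left_unitality X), id_tensorHom,
        leftUnitor_naturality_assoc]
      simp)
    (right_unitality := fun X => by
      simp only [Category.assoc]
      rw [tensorHom_comp_tensorHom_assoc]
      have h₁ : 𝟙 (G.obj X) ≫ e.inv.app X ⊗ₘ (hF.ε ≫ e.hom.app _) ≫ e.inv.app _ =
          (e.inv.app X ⊗ₘ 𝟙 _) ≫ (F.obj X ◁ hF.ε) := by
        rw [← id_tensorHom, tensorHom_comp_tensorHom]
        simp
      rw [h₁]
      simp only [Category.assoc]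
      rw [← e.hom.naturality, ← reassoc_of% (hF.right_unitality X), tensorHom_id,
        rightUnitor_naturality_assoc]
      simp)

variable {M : Type u₁} [Category.{v₁} M] [MonoidalCategory M]
  {C : Type u} [Category.{v} C] [MonoidalLeftAction M C]

/-- The canonical lax monoidal structure on `(U-)(A, A)`, which it receives as the functor
represented by the comonoid `Φ E_A`. -/
instance (A : C) : (Tambara.evalAt.{w} M A A).LaxMonoidal :=
  laxTransport (laxCoyoneda (Tambara.free.{w} (M := M) A A)) (Tambara.representation A A)

end Lax

end ProfunctorOptics

open ProfunctorOptics

/-! Write `p = ⟨l ∣ r⟩` with residual `m`, and `p̃` for the transformation `x ↦ P(l, r)(ζ x)`. A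
pair `x ∈ P(A, A)`, `y ∈ Q(A, A)` turns an element `⟨l ∣ c ∣ r⟩` of the double coend into `[P(l,
𝟙)(ζ x), Q(c, r)(ζ y)]` (`interpOptic₂`). Since `ζ [x, y] = [ζ x, ζ y]`, the value `p̃ [x, y]` is
the interpretation of `⟨l ∣ 𝟙 ∣ r⟩`. The pair `[p̃ x, p̃ y]` is the interpretation of `⟨l ∣ r ≫ l ∣
r⟩`, because `r` can be slid across the coend variable from `P` to `Q`. Hence `once p = twice p`
forces `p̃` to preserve pairs.

For the converse it is enough to find one interpretation that is injective. The universal choice is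
`P = Q = Φ E_A` with both elements the identity optic: there the interpretation is `⟨l ∣ c ∣ r⟩ ↦
[⟨l ∣ 𝟙⟩, ⟨c ∣ r⟩]`, and composing the inner legs (`pairToOptic₂`) is a left inverse. Only this
retraction is needed, not the full co-Yoneda bijection. The law `outside p = 𝟙 S` is the value of
`p̃` on `𝟙 A` in the hom-profunctor, since `p̃ (𝟙 A) = l ≫ r`.

It remains to identify the lax structure that the comonoid `Φ E_A` induces. Under the
representation, its unit is the counit evaluated at the identity optic, which is `𝟙 A`; its
multiplication comes from the comultiplication evaluated there, which gives `(x, y) ↦ [x, y]`.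
Monoidality of `p̃`, read on elements, is therefore the same pair of equations. -/

namespace ProfunctorOptics

variable {M : Type u₁} [Category.{v₁} M] [MonoidalCategory M]
  {C : Type u} [Category.{v} C] [MonoidalLeftAction M C]

namespace Tambara

/-! ### Interpreting the double coend in composites of Tambara modules -/

/-- Two elements `x ∈ P(A, A)` and `y ∈ Q(A, A)` interpret `⟨l ∣ c ∣ r⟩` as the class
`[P(l, 𝟙) (ζ x), Q(c, r) (ζ y)]` in `(P ⊙ Q)(S, S)`. -/
def interpOptic₂ {P Q : Tambara.{w} M C} {S A : C} (x : El P.prof A A) (y : El Q.prof A A) :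
    Optic₂ M S A → El (tensor P Q).prof S S :=
  Quot.lift
    (fun p => pair (p.res₁ ⊙ₗ A) (dimap P.prof p.l (𝟙 _) (P.ζ p.res₁ x))
      (dimap Q.prof p.c p.r (Q.ζ p.res₂ y)))
    (by
      rintro _ _ ⟨f, g, l, c, r⟩
      -- Dinaturality of `ζ` carries `f` from the contravariant to the covariant side of `P`, where
      -- it meets the coend variable, and carries `g` to the outer side of `Q`. The slide `h₃` then
      -- passes `f` on to `Q`.
      have h₁ := congrArg (dimap P.prof l (𝟙 _)) (P.ζ_dinatural f x)
      have h₂ := congrArg (dimap Q.prof c r) (Q.ζ_dinatural g y)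
      simp only [dimap_dimap, Category.comp_id, Category.id_comp] at h₁ h₂
      have h₃ := pair_slide (P := P) (Q := Q) (f ⊵ₗ A) (dimap P.prof l (𝟙 _) (P.ζ _ x))
        (dimap Q.prof c (g ⊵ₗ A ≫ r) (Q.ζ _ y))
      simp only [dimap_dimap, Category.comp_id, Category.id_comp] at h₃
      rw [← h₁, ← h₂]
      exact h₃)

@[simp]
theorem interpOptic₂_mk {P Q : Tambara.{w} M C} {S A : C} (x : El P.prof A A)
    (y : El Q.prof A A) (m₁ m₂ : M) (l : S ⟶ m₁ ⊙ₗ A) (c : m₁ ⊙ₗ A ⟶ m₂ ⊙ₗ A)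
    (r : m₂ ⊙ₗ A ⟶ S) :
    interpOptic₂ x y (Optic₂.mk m₁ m₂ l c r) =
      pair (P := P) (Q := Q) (m₁ ⊙ₗ A) (dimap P.prof l (𝟙 _) (P.ζ m₁ x))
        (dimap Q.prof c r (Q.ζ m₂ y)) := rfl

/-- Both `ζ` and the profunctor action on a composite work factorwise: `l` acts on the first factor,
`r` on the second, and nothing happens at the middle object `m ⊙ₗ A`. -/
theorem interpOptic₂_once (P Q : Tambara.{w} M C) {S A : C} (p : Optic M S S A A)
    (x : El P.prof A A) (y : El Q.prof A A) :
    interpOptic₂ x y p.once = (profunctorOptic.{w} p).app (P ⊗ Q) (pair A x y) := by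
  induction p using Optic.ind with
  | h m l r =>
    rw [profunctorOptic_mk]
    exact (dimap_pair P Q l r (P.ζ m x) (Q.ζ m y)).symm

/-- Applying the optic to each factor separately leaves the middle object at `S`. Sliding the first
factor's `r` over to the second moves it back to `m ⊙ₗ A` and creates the middle leg `r ≫ l`. -/
theorem interpOptic₂_twice (P Q : Tambara.{w} M C) {S A : C} (p : Optic M S S A A)
    (x : El P.prof A A) (y : El Q.prof A A) :
    interpOptic₂ x y p.twice =
      pair S ((profunctorOptic.{w} p).app P x) ((profunctorOptic.{w} p).app Q y) := by
  induction p using Optic.ind with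
  | h m l r =>
    rw [profunctorOptic_mk, profunctorOptic_mk]
    have h := pair_slide (P := P) (Q := Q) r (dimap P.prof l (𝟙 _) (P.ζ m x))
      (dimap Q.prof l r (Q.ζ m y))
    simp only [dimap_dimap, Category.comp_id, Category.id_comp] at h
    exact h.symm

/-! ### Recovering the double coend from the free module -/

/-- Composition of the inner legs: `[⟨l ∣ a⟩, ⟨b ∣ r⟩] ↦ ⟨l ∣ a ≫ b ∣ r⟩`. -/
def pairToOptic₂ {S A : C} :
    El (tensor (free.{w} (M := M) A A) (free.{w} (M := M) A A)).prof S S → Optic₂ M S A :=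
  pairLift
    (fun Z => repLift
      (fun m₁ l a => repLift (fun m₂ b r => Optic₂.mk m₁ m₂ l (a ≫ b) r)
        (fun {m n} t b r => by
          -- The relation of the double coend moves both residuals at once; an identity in one slot
          -- gives the slide in the other alone.
          have h := Optic₂.slide (𝟙 m₁) t l (a ≫ b) r
          simpa only [id_actionHomLeft, Category.id_comp, Category.comp_id,
            Category.assoc] using h))
      (fun {m n} t l a => by
        funext q
        induction q using rep_ind with
        | h m₂ b r =>
          have h := Optic₂.slide t (𝟙 m₂) l (a ≫ b) r
          simp only [id_actionHomLeft, Category.id_comp, Category.comp_id] at h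
          simp only [repLift_rep, Category.assoc]
          exact h))
    (by
      -- Independence of the coend variable `Z` is associativity of composition: `(a ≫ h) ≫ b = a ≫
      -- (h ≫ b)`.
      intro Z Z' h x y
      induction x using rep_ind with
      | h m l a =>
        induction y using rep_ind with
        | h n b r =>
          rw [dimap_rep, dimap_rep, repLift_rep, repLift_rep]
          change Optic₂.mk m n (𝟙 S ≫ l) ((a ≫ h) ≫ b) r =
            Optic₂.mk m n l (a ≫ h ≫ b) (r ≫ 𝟙 S)
          simp)

@[simp]
theorem pairToOptic₂_pair {S A Z : C} (m₁ m₂ : M) (l : S ⟶ m₁ ⊙ₗ A) (a : m₁ ⊙ₗ A ⟶ Z)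
    (b : Z ⟶ m₂ ⊙ₗ A) (r : m₂ ⊙ₗ A ⟶ S) :
    pairToOptic₂ (pair Z (rep.{w} m₁ l a) (rep.{w} m₂ b r)) =
      Optic₂.mk m₁ m₂ l (a ≫ b) r := rfl

/-- `Optic₂ M S A` is a retract of `(Φ E_A ⊙ Φ E_A)(S, S)`. -/
theorem pairToOptic₂_interpOptic₂ {S A : C} (q : Optic₂ M S A) :
    pairToOptic₂ (interpOptic₂ (idEl.{w} M A A) (idEl.{w} M A A) q) = q := by
  obtain ⟨m₁, m₂, l, c, r⟩ := q
  change pairToOptic₂ (interpOptic₂ (idEl.{w} M A A) (idEl.{w} M A A)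
    (Optic₂.mk m₁ m₂ l c r)) = Optic₂.mk m₁ m₂ l c r
  -- Every optic is obtained from the identity optic by `ζ` and the profunctor action, so the
  -- interpretation is `[⟨l ∣ 𝟙⟩, ⟨c ∣ r⟩]`, and its inner legs compose to `𝟙 ≫ c`.
  rw [interpOptic₂_mk, dimap_ζ_idEl, dimap_ζ_idEl, pairToOptic₂_pair, Category.id_comp]

/-! ### Lawfulness in terms of the profunctor optic -/

/-- In the hom-profunctor `ζ` is the action of `m`, which preserves identities, so only `l ≫ r`
survives. -/
theorem profunctorOptic_app_unit {S A : C} (p : Optic M S S A A) :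
    (profunctorOptic.{w} p).app (𝟙_ (Tambara.{w} M C)) (ofHom (M := M) (𝟙 A)) =
      ofHom (M := M) p.outside := by
  induction p using Optic.ind with
  | h m l r =>
    rw [profunctorOptic_mk]
    refine (unit_dimap l r _).trans ?_
    change ofHom (l ≫ (m ⊴ₗ 𝟙 A) ≫ r) = ofHom (l ≫ r)
    simp

theorem isLawful_iff_profunctorOptic {S A : C} (p : Optic M S S A A) :
    p.IsLawful ↔
      (profunctorOptic.{w} p).app (𝟙_ (Tambara.{w} M C)) (ofHom (M := M) (𝟙 A)) =
          ofHom (M := M) (𝟙 S) ∧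
      ∀ (P Q : Tambara.{w} M C) (x : El P.prof A A) (y : El Q.prof A A),
        (profunctorOptic.{w} p).app (P ⊗ Q) (pair A x y) =
          pair S ((profunctorOptic.{w} p).app P x) ((profunctorOptic.{w} p).app Q y) := by
  constructor
  · rintro ⟨h₁, h₂⟩
    refine ⟨by rw [profunctorOptic_app_unit, h₁], fun P Q x y => ?_⟩
    rw [← interpOptic₂_once, ← interpOptic₂_twice, h₂]
  · rintro ⟨h₁, h₂⟩
    refine ⟨?_, ?_⟩
    · rw [profunctorOptic_app_unit] at h₁
      exact congrArg (toHom.{w} (M := M)) h₁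
    -- The universal test case: at the identity optics the interpretation has a left inverse, so
    -- equality of the interpretations of `once p` and `twice p` gives equality of the two elements.
    · have h := h₂ (free A A) (free A A) (idEl M A A) (idEl M A A)
      rw [← interpOptic₂_once, ← interpOptic₂_twice] at h
      rw [← pairToOptic₂_interpOptic₂.{w} p.once, h, pairToOptic₂_interpOptic₂]

/-! ### The lax monoidal structure on elements -/

/-- The unit of the lax monoidal structure on `(U-)(A, A)` picks out the identity of `A`. -/
theorem evalAt_ε_apply (A : C) (x : 𝟙_ (Type (max w u v u₁))) :
    Functor.LaxMonoidal.ε (evalAt.{w} M A A) x = ofHom (M := M) (𝟙 A) := by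
  change ev (freeCounit A).hom (rep.{w} (𝟙_ M) (λₗ A).inv (λₗ A).hom) = _
  rw [ev_freeCounit, Iso.inv_hom_id]

/-- The multiplication of the lax monoidal structure on `(U-)(A, A)` is `(x, y) ↦ [x, y]`. -/
theorem evalAt_μ_apply (A : C) (P Q : Tambara.{w} M C) (x : El P.prof A A)
    (y : El Q.prof A A) :
    Functor.LaxMonoidal.μ (evalAt.{w} M A A) P Q (x, y) = pair A x y := by
  -- Unfolds the transported structure: `x` and `y` become morphisms out of `Φ E_A`, are multiplied
  -- by precomposing with the comultiplication, and the result is evaluated at the identity optic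
  -- `⟨λ⁻¹ ∣ λ⟩`.
  change ev (ofEl x ⊗ₘ ofEl y).hom
    (ev (freeComul A).hom (rep.{w} (𝟙_ M) (λₗ A).inv (λₗ A).hom)) = _
  rw [ev_freeComul, ev_tensorHom, ev_ofEl, ev_ofEl]
  -- The middle object is `𝟙_ M ⊙ₗ A` rather than `A`. Sliding along the unitor completes each
  -- factor to the form required by `ζ_unit`, which turns the factors into `x` and `y`.
  have h := pair_slide (P := P) (Q := Q) (λₗ[M] A).hom
    (dimap P.prof (λₗ[M] A).inv (𝟙 _) (P.ζ (𝟙_ M) x))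
    (dimap Q.prof (λₗ[M] A).inv (λₗ[M] A).hom (Q.ζ (𝟙_ M) y))
  simp only [dimap_dimap, Iso.hom_inv_id, Category.id_comp, Category.comp_id] at h
  rw [P.ζ_unit, Q.ζ_unit] at h
  exact h.symm

/-- A transformation `(U-)(A, A) ⟶ (U-)(S, S)` is monoidal iff it preserves identities and
classes of pairs. -/
theorem isMonoidal_iff {S A : C} (τ : evalAt.{w} M A A ⟶ evalAt.{w} M S S) :
    NatTrans.IsMonoidal τ ↔
      τ.app (𝟙_ (Tambara.{w} M C)) (ofHom (M := M) (𝟙 A)) = ofHom (M := M) (𝟙 S) ∧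
      ∀ (P Q : Tambara.{w} M C) (x : El P.prof A A) (y : El Q.prof A A),
        τ.app (P ⊗ Q) (pair A x y) = pair S (τ.app P x) (τ.app Q y) := by
  constructor
  · intro h
    refine ⟨?_, fun P Q x y => ?_⟩
    · exact (congrArg (τ.app _) (evalAt_ε_apply A PUnit.unit)).symm.trans
        ((ConcreteCategory.congr_hom h.unit PUnit.unit).trans (evalAt_ε_apply S PUnit.unit))
    · have e : τ.app (P ⊗ Q) (Functor.LaxMonoidal.μ (evalAt.{w} M A A) P Q (x, y)) =
          Functor.LaxMonoidal.μ (evalAt.{w} M S S) P Q (τ.app P x, τ.app Q y) :=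
        ConcreteCategory.congr_hom (h.tensor P Q) _
      exact (congrArg (τ.app _) (evalAt_μ_apply A P Q x y)).symm.trans
        (e.trans (evalAt_μ_apply S P Q (τ.app P x) (τ.app Q y)))
  · rintro ⟨h₁, h₂⟩
    refine ⟨?_, fun P Q => ?_⟩
    · ext x
      exact (congrArg (τ.app _) (evalAt_ε_apply A x)).trans
        (h₁.trans (evalAt_ε_apply S x).symm)
    · ext ⟨x, y⟩
      exact (congrArg (τ.app _) (evalAt_μ_apply A P Q x y)).trans
        ((h₂ P Q x y).trans (evalAt_μ_apply S P Q (τ.app P x) (τ.app Q y)).symm)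

end Tambara

end ProfunctorOptics

theorem mainTheorem6 {M : Type u₁} [Category.{v₁} M] [MonoidalCategory M]
    {C : Type u} [Category.{v} C] [MonoidalLeftAction M C] {S A : C} (p : Optic M S S A A) :
    (p.IsLawful ↔ NatTrans.IsMonoidal (Tambara.profunctorOptic.{w} p)) ∧
    (p.IsLawful ↔
      (Tambara.profunctorOptic.{w} p).app (𝟙_ (Tambara.{w} M C)) (Tambara.ofHom (M := M) (𝟙 A)) =
          Tambara.ofHom (M := M) (𝟙 S) ∧
      ∀ (P Q : Tambara.{w} M C) (x : El P.prof A A) (y : El Q.prof A A),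
        (Tambara.profunctorOptic.{w} p).app (P ⊗ Q) (Tambara.pair A x y) =
          Tambara.pair S ((Tambara.profunctorOptic.{w} p).app P x)
            ((Tambara.profunctorOptic.{w} p).app Q y)) := by
  exact ⟨(Tambara.isLawful_iff_profunctorOptic p).trans (Tambara.isMonoidal_iff _).symm,
    Tambara.isLawful_iff_profunctorOptic p⟩
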